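/- Let $n\ge 1$ be an integer. A polyhedron in $\mathbb R^n$ is the solution set of a finite system of inequalities $Ax\le b$; a face of a polyhedron $P$ is a set $P\cap\{x : a^\top x=c\}$ where $a^\top x\le c$ is valid on $P$ (so $\emptyset$ and $P$ are faces). A polyhedral complex is a collection of polyhedra that contains every face of each of its members and in which the intersection of any two members is a common face of both. A function $f:\mathbb R^n\to\mathbb R$ is piecewise linear if there is a finite polyhedral complex covering $\mathbb R^n$ such that $f$ is affine on the relative interior of each polyhedron of the complex; $\mathrm{PWL}_n$ is the class of all (possibly discontinuous) piecewise linear functions and $\mathrm{CPWL}_n$ the class of the continuous ones. For $k\ge 0$, let $\mathrm{ReLU}_n(k)$ be the class of functions $\mathbb R^n\to\mathbb R$ of the form $T_{k+1}\circ\sigma\circ T_k\circ\cdots\circ T_2\circ\sigma\circ T_1$, where $\sigma(t)=\max\{0,t\}$ is applied coordinatewise and $T_i:\mathbb R^{w_{i-1}}\to\mathbb R^{w_i}$ are affine maps with $w_0=n$, $w_{k+1}=1$ and arbitrary widths $w_1,\dots,w_k\in\mathbb N$. Let $\mathrm{SLT}_n(k)$ (shortcut linear threshold networks with $k$ hidden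 layers) be the class of functions $x\mapsto\langle A^\top x+b,\,x^{(k)}\rangle$, where $x^{(k)}=(\tau\circ T_k\circ\cdots\circ\tau\circ T_1)(x)\in\mathbb R^{w_k}$ with affine maps $T_i$ as above, $\tau$ is the threshold function ($\tau(t)=1$ if $t>0$ and $\tau(t)=0$ otherwise) applied coordinatewise, $A\in\mathbb R^{n\times w_k}$ and $b\in\mathbb R^{w_k}$. Theorem. For every integer $n\ge 1$, $$\mathrm{ReLU}_n(\lceil\log_2(n+1)\rceil)=\mathrm{CPWL}_n\subsetneq\mathrm{PWL}_n=\mathrm{SLT}_n(2).$$ In particular, shortcut linear threshold networks with 2 hidden layers represent exactly the (possibly discontinuous) piecewise linear functions. -/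

import Mathlib

open scoped Matrix

/-! Piecewise linear functions. The space `ℝⁿ` is `Fin n → ℝ`; only its affine structure and its
(usual) topology play a role. -/

/-- A polyhedron in `ℝⁿ`: the solution set of finitely many (possibly zero) weak linear
inequalities `A x ≤ b`. The empty set and `ℝⁿ` are polyhedra. -/
def IsPolyhedron {n : ℕ} (P : Set (Fin n → ℝ)) : Prop :=
  ∃ (m : ℕ) (A : Matrix (Fin m) (Fin n) ℝ) (b : Fin m → ℝ), P = {x | A *ᵥ x ≤ b}

/-- `F` is a face of `P`: `F = P ∩ {x | a ⬝ᵥ x = c}` for an inequality `a ⬝ᵥ x ≤ c` that is valid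
on `P`. The choices `a = 0`, `c = 0` and `a = 0`, `c = 1` give the faces `P` and `∅`. -/
def IsFaceOf {n : ℕ} (F P : Set (Fin n → ℝ)) : Prop :=
  ∃ (a : Fin n → ℝ) (c : ℝ), (∀ x ∈ P, a ⬝ᵥ x ≤ c) ∧ F = {x ∈ P | a ⬝ᵥ x = c}

/-- A polyhedral complex in `ℝⁿ`: a collection of polyhedra that is closed under taking faces and
in which any two members intersect in a common face. -/
structure IsPolyhedralComplex {n : ℕ} (K : Set (Set (Fin n → ℝ))) : Prop where
  isPolyhedron : ∀ P ∈ K, IsPolyhedron P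
  inter_isFaceOf : ∀ P ∈ K, ∀ Q ∈ K, IsFaceOf (P ∩ Q) P ∧ IsFaceOf (P ∩ Q) Q
  face_mem : ∀ P ∈ K, ∀ F, IsFaceOf F P → F ∈ K

/-- The class of (possibly discontinuous) piecewise linear functions `ℝⁿ → ℝ`: there is a finite
polyhedral complex covering `ℝⁿ` such that the function is affine on the relative interior
(`intrinsicInterior`) of each polyhedron of the complex. -/
def PWL (n : ℕ) : Set ((Fin n → ℝ) → ℝ) :=
  {f | ∃ K : Set (Set (Fin n → ℝ)), K.Finite ∧ IsPolyhedralComplex K ∧ ⋃₀ K = Set.univ ∧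
    ∀ P ∈ K, ∃ g : (Fin n → ℝ) →ᵃ[ℝ] ℝ, Set.EqOn f g (intrinsicInterior ℝ P)}

/-- The class of continuous piecewise linear functions `ℝⁿ → ℝ`. -/
def CPWL (n : ℕ) : Set ((Fin n → ℝ) → ℝ) :=
  {f | f ∈ PWL n ∧ Continuous f}

/-! Neural networks. -/

/-- The hidden part of a neural network: `HiddenLayers n k w` is a chain of affine maps
`T₁ : ℝ^{w₀} → ℝ^{w₁}`, …, `T_k : ℝ^{w_{k-1}} → ℝ^{w_k}` with `w₀ = n`, `w_k = w` and arbitrary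
widths in between. -/
inductive HiddenLayers (n : ℕ) : ℕ → ℕ → Type
  | input : HiddenLayers n 0 n
  | layer {k w w' : ℕ} (H : HiddenLayers n k w) (T : (Fin w → ℝ) →ᵃ[ℝ] (Fin w' → ℝ)) :
      HiddenLayers n (k + 1) w'

/-- The output `x⁽ᵏ⁾ = (σ ∘ T_k ∘ ⋯ ∘ σ ∘ T₁) x` of the last hidden layer, where the activation
function `σ` is applied coordinatewise. -/
def HiddenLayers.eval (σ : ℝ → ℝ) {n : ℕ} :
    {k w : ℕ} → HiddenLayers n k w → (Fin n → ℝ) → (Fin w → ℝ)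
  | _, _, .input, x => x
  | _, _, .layer H T, x => fun j => σ (T (H.eval σ x) j)

/-- A neural network `ℝⁿ → ℝᵐ` with `k` hidden layers: hidden layers followed by one more affine
map `T_{k+1}`. -/
structure NeuralNetwork (n k m : ℕ) where
  width : ℕ
  hidden : HiddenLayers n k width
  output : (Fin width → ℝ) →ᵃ[ℝ] (Fin m → ℝ)

/-- The function `T_{k+1} ∘ σ ∘ T_k ∘ ⋯ ∘ σ ∘ T₁` computed by a network with activation `σ`. -/
def NeuralNetwork.eval (σ : ℝ → ℝ) {n k m : ℕ} (N : NeuralNetwork n k m) (x : Fin n → ℝ) :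
    Fin m → ℝ :=
  N.output (N.hidden.eval σ x)

/-- The rectified linear unit. -/
noncomputable def reluActivation (t : ℝ) : ℝ := max 0 t

/-- The threshold activation: the indicator function of the positive reals. -/
noncomputable def thresholdActivation (t : ℝ) : ℝ := if 0 < t then 1 else 0

/-- The functions `ℝⁿ → ℝ` represented by ReLU networks with `k` hidden layers. -/
def ReLUClass (n k : ℕ) : Set ((Fin n → ℝ) → ℝ) :=
  {f | ∃ N : NeuralNetwork n k 1, ∀ x, f x = N.eval reluActivation x 0}

/-- A shortcut network `ℝⁿ → ℝ` with `k` hidden layers: hidden layers together with the matrix `A`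
and the vector `b` of the shortcut connection. -/
structure ShortcutNetwork (n k : ℕ) where
  width : ℕ
  hidden : HiddenLayers n k width
  A : Matrix (Fin n) (Fin width) ℝ
  b : Fin width → ℝ

/-- The output `⟨Aᵀ x + b, x⁽ᵏ⁾⟩` of a shortcut linear threshold network, where `x⁽ᵏ⁾` is the output
of the last hidden layer with threshold activations. -/
noncomputable def ShortcutNetwork.eval {n k : ℕ} (N : ShortcutNetwork n k) (x : Fin n → ℝ) : ℝ :=
  (N.Aᵀ *ᵥ x + N.b) ⬝ᵥ N.hidden.eval thresholdActivation x

/-- The functions `ℝⁿ → ℝ` represented by shortcut linear threshold networks with `k` hidden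
layers. -/
def SLTClass (n k : ℕ) : Set ((Fin n → ℝ) → ℝ) :=
  {f | ∃ N : ShortcutNetwork n k, ∀ x, f x = N.eval x}

/-! Polyhedral complexes are traded for sign cells: by `mem_PWL_iff`, `f` is piecewise linear iff
some finite set `L` of affine maps makes `f` affine wherever all signs of `L` are fixed.

A continuous piecewise linear `f` is then a continuous selection from finitely many affine maps. An
argument on segments makes it a max of mins of these maps, hence a difference of two maxima
(`isMaxAffineDiff_of_selection`). An affine dependence with inclusion-exclusion reduces any maximum
to maxima of at most `n + 1` maps (`maxOf_mem_of_forall_card_le`), and a binary tree of pairwise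
maxima evaluates `2 ^ k` maps in `k` ReLU layers.

For threshold networks, layer one reads the signs of `L`, layer two outputs indicators of sign
cells, and the shortcut multiplies each by its affine piece. Conversely, the signs of the
first-layer preactivations determine all hidden outputs. -/

section SignCells

variable {n : ℕ}

/-! ### Polyhedra, faces and relative interiors via affine maps -/

theorem exists_forall_eq_dotProduct_sub (ℓ : (Fin n → ℝ) →ᵃ[ℝ] ℝ) :
    ∃ (a : Fin n → ℝ) (c : ℝ), ∀ x, ℓ x = a ⬝ᵥ x - c := by
  refine ⟨fun i => ℓ.linear (Pi.single i 1), -ℓ 0, fun x => ?_⟩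
  have h := congrFun ℓ.decomp x
  simp only [Pi.add_apply] at h
  rw [h, LinearMap.pi_apply_eq_sum_univ ℓ.linear x, sub_neg_eq_add]
  simp only [dotProduct, smul_eq_mul, mul_comm]
  congr 1
  refine Finset.sum_congr rfl fun i _ => ?_
  congr 2
  ext j
  simp [Pi.single_apply, eq_comm]

theorem exists_affineMap_eq_dotProduct_sub (a : Fin n → ℝ) (c : ℝ) :
    ∃ ℓ : (Fin n → ℝ) →ᵃ[ℝ] ℝ, ∀ x, ℓ x = a ⬝ᵥ x - c :=
  ⟨(dotProductBilin ℝ ℝ a).toAffineMap - AffineMap.const ℝ _ c, fun x => by simp⟩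

theorem isPolyhedron_iff {P : Set (Fin n → ℝ)} :
    IsPolyhedron P ↔ ∃ L : Finset ((Fin n → ℝ) →ᵃ[ℝ] ℝ), P = {x | ∀ ℓ ∈ L, ℓ x ≤ 0} := by
  classical
  constructor
  · rintro ⟨m, A, b, rfl⟩
    choose ℓ hℓ using fun i => exists_affineMap_eq_dotProduct_sub (A i) (b i)
    refine ⟨Finset.univ.image ℓ, ?_⟩
    ext x
    simp [hℓ, Pi.le_def, Matrix.mulVec]
  · rintro ⟨L, rfl⟩
    choose a c h using fun ℓ : (Fin n → ℝ) →ᵃ[ℝ] ℝ => exists_forall_eq_dotProduct_sub ℓ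
    refine ⟨L.card, Matrix.of fun i => a (L.equivFin.symm i), fun i => c (L.equivFin.symm i), ?_⟩
    ext x
    simp only [Set.mem_ofPred_eq, Pi.le_def, Matrix.mulVec, Matrix.of_apply]
    constructor
    · intro hx i
      have := hx _ (L.equivFin.symm i).2
      rw [h] at this
      linarith
    · intro hx ℓ hℓ
      have := hx (L.equivFin ⟨ℓ, hℓ⟩)
      simp only [Equiv.symm_apply_apply] at this
      rw [h]
      linarith

theorem isFaceOf_iff {F P : Set (Fin n → ℝ)} :
    IsFaceOf F P ↔ ∃ ℓ : (Fin n → ℝ) →ᵃ[ℝ] ℝ, (∀ x ∈ P, ℓ x ≤ 0) ∧ F = {x ∈ P | ℓ x = 0} := by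
  constructor
  · rintro ⟨a, c, h, rfl⟩
    obtain ⟨ℓ, hℓ⟩ := exists_affineMap_eq_dotProduct_sub a c
    exact ⟨ℓ, fun x hx => by simpa [hℓ] using h x hx, by simp [hℓ, sub_eq_zero]⟩
  · rintro ⟨ℓ, h, rfl⟩
    obtain ⟨a, c, hℓ⟩ := exists_forall_eq_dotProduct_sub ℓ
    exact ⟨a, c, fun x hx => by simpa [hℓ] using h x hx, by simp [hℓ, sub_eq_zero]⟩

theorem isFaceOf_empty (P : Set (Fin n → ℝ)) : IsFaceOf ∅ P :=
  ⟨0, 1, by simp, by simp⟩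

/-- Constraints tight at `x` are tight on the whole polyhedron, hence on its affine span; the other
constraints are strict at `x` and cut out a neighbourhood of it in the span. -/
theorem mem_intrinsicInterior_of_forall {L : Finset ((Fin n → ℝ) →ᵃ[ℝ] ℝ)} {x : Fin n → ℝ}
    (hx : ∀ ℓ ∈ L, ℓ x ≤ 0)
    (h : ∀ ℓ ∈ L, ℓ x = 0 → ∀ y, (∀ ℓ' ∈ L, ℓ' y ≤ 0) → ℓ y = 0) :
    x ∈ intrinsicInterior ℝ {y | ∀ ℓ ∈ L, ℓ y ≤ 0} := by
  classical
  set P : Set (Fin n → ℝ) := {y | ∀ ℓ ∈ L, ℓ y ≤ 0} with hP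
  rw [mem_intrinsicInterior]
  refine ⟨⟨x, subset_affineSpan ℝ P hx⟩, ?_, rfl⟩
  rw [mem_interior]
  refine ⟨⋂ ℓ ∈ L.filter (fun ℓ => ℓ x < 0), {y | ℓ (y : Fin n → ℝ) < 0}, ?_, ?_, ?_⟩
  · intro y hy
    simp only [Set.mem_iInter, Finset.mem_filter, Set.mem_ofPred_eq] at hy
    change ∀ ℓ ∈ L, ℓ y ≤ 0
    intro ℓ hℓ
    rcases (hx ℓ hℓ).lt_or_eq with h1 | h1
    · exact (hy ℓ ⟨hℓ, h1⟩).le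
    · have hsub : affineSpan ℝ P ≤ (affineSpan ℝ {(0 : ℝ)}).comap ℓ := by
        rw [affineSpan_le]
        intro z hz
        simpa using h ℓ hℓ h1 z hz
      exact ((AffineSubspace.mem_affineSpan_singleton ℝ ℝ).1 (hsub y.2)).le
  · refine isOpen_biInter_finset fun ℓ _ => ?_
    exact isOpen_lt (ℓ.continuous_of_finiteDimensional.comp continuous_subtype_val)
      continuous_const
  · simp

theorem exists_lineMap_mem_of_mem_intrinsicInterior {P : Set (Fin n → ℝ)} {x z : Fin n → ℝ}
    (hx : x ∈ intrinsicInterior ℝ P) (hz : z ∈ P) :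
    ∃ t : ℝ, 1 < t ∧ AffineMap.lineMap z x t ∈ P := by
  rw [mem_intrinsicInterior] at hx
  obtain ⟨y, hy, rfl⟩ := hx
  let c : ℝ → affineSpan ℝ P := fun t =>
    ⟨AffineMap.lineMap z (y : Fin n → ℝ) t,
      AffineMap.lineMap_mem t (subset_affineSpan ℝ P hz) y.2⟩
  have hc : Continuous c := AffineMap.lineMap_continuous.subtype_mk _
  have h1 : c 1 = y := by ext1; simp [c]
  have hn : c ⁻¹' interior ((↑) ⁻¹' P) ∈ nhds (1 : ℝ) :=
    (isOpen_interior.preimage hc).mem_nhds (by simpa [h1] using hy)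
  have hn' : ∀ᶠ t in nhdsWithin 1 (Set.Ioi 1), c t ∈ interior ((↑) ⁻¹' P) :=
    mem_nhdsWithin_of_mem_nhds hn
  obtain ⟨t, ht, ht'⟩ := (hn'.and self_mem_nhdsWithin).exists
  have hmem : c t ∈ ((↑) ⁻¹' P : Set (affineSpan ℝ P)) := interior_subset ht
  exact ⟨t, ht', hmem⟩

/-- `f` agrees with an affine map on every set of points on which all maps in `L` have constant
signs. -/
def IsAffineOnSignCells (L : Finset ((Fin n → ℝ) →ᵃ[ℝ] ℝ)) (f : (Fin n → ℝ) → ℝ) : Prop :=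
  ∀ s : L → SignType, ∃ g : (Fin n → ℝ) →ᵃ[ℝ] ℝ,
    ∀ x, (∀ ℓ : L, SignType.sign (ℓ.1 x) = s ℓ) → f x = g x

/-- The closure of the sign cell of `x₀`. -/
def closedSignCell (L : Finset ((Fin n → ℝ) →ᵃ[ℝ] ℝ)) (x₀ : Fin n → ℝ) : Set (Fin n → ℝ) :=
  {x | ∀ ℓ ∈ L, SignType.sign (ℓ x) = SignType.sign (ℓ x₀) ∨ ℓ x = 0}

/-! ### The complex of closed sign cells -/

variable {L : Finset ((Fin n → ℝ) →ᵃ[ℝ] ℝ)} {f : (Fin n → ℝ) → ℝ}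

theorem sign_eq_or_eq_zero_iff (a b : ℝ) :
    (SignType.sign a = SignType.sign b ∨ a = 0) ↔ 0 ≤ a * b ∧ (b = 0 → a = 0) := by
  rcases lt_trichotomy a 0 with ha | rfl | ha
  · rcases lt_trichotomy b 0 with hb | rfl | hb
    · simp [ha, hb, hb.ne, (mul_pos_of_neg_of_neg ha hb).le]
    · simp [ha]
    · simp [ha, hb, ha.ne, hb.ne']
  · simp
  · rcases lt_trichotomy b 0 with hb | rfl | hb
    · simp [ha, hb, ha.ne', hb.ne]
    · simp [ha]
    · simp [ha, hb, hb.ne', (mul_pos ha hb).le]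

theorem self_mem_closedSignCell (x : Fin n → ℝ) : x ∈ closedSignCell L x := fun _ _ => .inl rfl

theorem isPolyhedron_closedSignCell (x₀ : Fin n → ℝ) : IsPolyhedron (closedSignCell L x₀) := by
  classical
  rw [isPolyhedron_iff]
  -- The first family encodes `0 ≤ ℓ x * ℓ x₀`; the pairs `ℓ`, `-ℓ` encode `ℓ x = 0` for maps
  -- vanishing at `x₀`.
  refine ⟨L.image (fun ℓ => -(ℓ x₀) • ℓ) ∪ ((L.filter (fun ℓ => ℓ x₀ = 0)) ∪
    (L.filter (fun ℓ => ℓ x₀ = 0)).image (fun ℓ => -ℓ)), ?_⟩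
  ext x
  simp only [closedSignCell, sign_eq_or_eq_zero_iff, Set.mem_ofPred_eq, Finset.mem_union,
    Finset.mem_image, Finset.mem_filter]
  constructor
  · rintro h _ (⟨ℓ, hℓ, rfl⟩ | ⟨hℓ, h0⟩ | ⟨ℓ, ⟨hℓ, h0⟩, rfl⟩)
    · have := (h _ hℓ).1
      simp only [AffineMap.coe_smul, Pi.smul_apply, smul_eq_mul]
      linarith
    · exact ((h _ hℓ).2 h0).le
    · simp [(h _ hℓ).2 h0]
  · intro h ℓ hℓ
    refine ⟨?_, fun h0 => le_antisymm (h _ (.inr (.inl ⟨hℓ, h0⟩))) ?_⟩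
    · have := h _ (.inl ⟨ℓ, hℓ, rfl⟩)
      simp only [AffineMap.coe_smul, Pi.smul_apply, smul_eq_mul] at this
      linarith
    · simpa using h _ (.inr (.inr ⟨ℓ, ⟨hℓ, h0⟩, rfl⟩))

theorem finite_range_closedSignCell : (Set.range (closedSignCell L)).Finite := by
  refine (Set.finite_range fun s : L → SignType =>
    {x | ∀ ℓ : L, SignType.sign (ℓ.1 x) = s ℓ ∨ ℓ.1 x = 0}).subset ?_
  rintro _ ⟨x₀, rfl⟩
  exact ⟨fun ℓ => SignType.sign (ℓ.1 x₀), by ext x; simp [closedSignCell]⟩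

/-- The supporting map is minus the sum of `ℓ x₀ • ℓ` over the maps whose signs at `x₀` and `x₁`
differ. Each summand is nonnegative on the cell, so the sum vanishes only if all of them do. -/
theorem isFaceOf_closedSignCell_inter (x₀ x₁ : Fin n → ℝ) :
    IsFaceOf (closedSignCell L x₀ ∩ closedSignCell L x₁) (closedSignCell L x₀) := by
  classical
  set M := L.filter fun ℓ => SignType.sign (ℓ x₀) ≠ SignType.sign (ℓ x₁)
  have happ : ∀ x, (-∑ ℓ ∈ M, ℓ x₀ • ℓ) x = -∑ ℓ ∈ M, ℓ x * ℓ x₀ := by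
    intro x
    let e : ((Fin n → ℝ) →ᵃ[ℝ] ℝ) →+ ℝ := ⟨⟨fun ℓ => ℓ x, rfl⟩, fun _ _ => rfl⟩
    have := map_sum e (fun ℓ => ℓ x₀ • ℓ) M
    simp only [e, AddMonoidHom.coe_mk, ZeroHom.coe_mk] at this
    simp [this, mul_comm]
  rw [isFaceOf_iff]
  have hnn : ∀ x ∈ closedSignCell L x₀, ∀ ℓ ∈ M, 0 ≤ ℓ x * ℓ x₀ := fun x hx ℓ hℓ =>
    ((sign_eq_or_eq_zero_iff _ _).1 (hx ℓ (Finset.mem_filter.1 hℓ).1)).1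
  refine ⟨-∑ ℓ ∈ M, ℓ x₀ • ℓ, fun x hx => ?_, ?_⟩
  · rw [happ]
    exact neg_nonpos.2 (Finset.sum_nonneg (hnn x hx))
  · ext x
    simp only [Set.mem_inter_iff, Set.mem_ofPred_eq, happ, neg_eq_zero]
    refine and_congr_right fun hx => ?_
    rw [Finset.sum_eq_zero_iff_of_nonneg (hnn x hx)]
    constructor
    · intro h ℓ hℓ
      rw [Finset.mem_filter] at hℓ
      rcases hx ℓ hℓ.1 with h0 | h0
      · rcases h ℓ hℓ.1 with h1 | h1
        · exact absurd (h0.symm.trans h1) hℓ.2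
        · simp [h1]
      · simp [h0]
    · intro h ℓ hℓ
      by_cases hs : SignType.sign (ℓ x₀) = SignType.sign (ℓ x₁)
      · rw [← hs]
        exact hx ℓ hℓ
      · right
        have h2 := ((sign_eq_or_eq_zero_iff _ _).1 (hx ℓ hℓ)).2
        rcases mul_eq_zero.1 (h ℓ (Finset.mem_filter.2 ⟨hℓ, hs⟩)) with h1 | h1
        · exact h1
        · exact h2 h1

/-- A point `x₁` of `F` at which the fewest maps of `L` vanish acts as a relative interior point.
From any `y` in its closed cell, the segment to `x₁` extends past `x₁` inside the big cell, where `φ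
≤ 0`; since `φ x₁ = 0`, this forces `φ y = 0`. -/
theorem eq_closedSignCell_of_isFaceOf {x₀ : Fin n → ℝ} {F : Set (Fin n → ℝ)}
    (hF : IsFaceOf F (closedSignCell L x₀)) (hne : F.Nonempty) :
    ∃ x₁, F = closedSignCell L x₁ := by
  classical
  obtain ⟨φ, hφ, rfl⟩ := isFaceOf_iff.1 hF
  set F : Set (Fin n → ℝ) := {x ∈ closedSignCell L x₀ | φ x = 0}
  let Z : (Fin n → ℝ) → Finset ((Fin n → ℝ) →ᵃ[ℝ] ℝ) := fun x => L.filter fun ℓ => ℓ x = 0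
  obtain ⟨x₁, hx₁, hmin⟩ : ∃ x₁ ∈ F, ∀ y ∈ F, (Z x₁).card ≤ (Z y).card :=
    ⟨Function.argminOn (fun x => (Z x).card) F hne, Function.argminOn_mem _ _ _,
      fun y hy => Function.argminOn_le (fun x => (Z x).card) _ hy⟩
  have hz : ∀ y ∈ F, ∀ ℓ ∈ L, ℓ x₁ = 0 → ℓ y = 0 := by
    intro y hy ℓ hℓ h0
    by_contra hne
    have happ : ∀ ℓ : (Fin n → ℝ) →ᵃ[ℝ] ℝ, ℓ (midpoint ℝ x₁ y) = (ℓ x₁ + ℓ y) / 2 := by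
      intro ℓ
      rw [AffineMap.map_midpoint, midpoint_eq_smul_add, smul_eq_mul]
      simp; ring
    have key : ∀ ℓ ∈ L, (0 ≤ ℓ x₁ * ℓ x₀ ∧ (ℓ x₀ = 0 → ℓ x₁ = 0)) ∧
        (0 ≤ ℓ y * ℓ x₀ ∧ (ℓ x₀ = 0 → ℓ y = 0)) := fun ℓ hℓ =>
      ⟨(sign_eq_or_eq_zero_iff _ _).1 (hx₁.1 ℓ hℓ), (sign_eq_or_eq_zero_iff _ _).1 (hy.1 ℓ hℓ)⟩
    have hmF : midpoint ℝ x₁ y ∈ F := by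
      refine ⟨fun ℓ hℓ => (sign_eq_or_eq_zero_iff _ _).2 ?_, ?_⟩
      · obtain ⟨⟨h1, h2⟩, h3, h4⟩ := key ℓ hℓ
        rw [happ]
        refine ⟨by linarith, fun h => by simp [h2 h, h4 h]⟩
      · rw [happ, hx₁.2, hy.2]; simp
    -- Values at `x₁` and `y` never have opposite signs, so a map vanishing at the midpoint vanishes
    -- at `x₁`; `ℓ` vanishes only at the latter.
    refine (hmin _ hmF).not_gt (Finset.card_lt_card ?_)
    rw [Finset.ssubset_iff_of_subset]
    · refine ⟨ℓ, Finset.mem_filter.2 ⟨hℓ, h0⟩, fun hm => hne ?_⟩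
      have := (Finset.mem_filter.1 hm).2
      rw [happ, h0] at this
      linarith
    · intro ℓ' hm
      obtain ⟨hℓ', h⟩ := Finset.mem_filter.1 hm
      refine Finset.mem_filter.2 ⟨hℓ', ?_⟩
      obtain ⟨⟨h1, h2⟩, h3, h4⟩ := key ℓ' hℓ'
      rw [happ] at h
      have hyx : ℓ' y = -ℓ' x₁ := by linarith
      rw [hyx] at h3
      rcases mul_eq_zero.1 (by linarith : ℓ' x₁ * ℓ' x₀ = 0) with h5 | h5
      · exact h5
      · exact h2 h5
  refine ⟨x₁, Set.Subset.antisymm ?_ ?_⟩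
  · intro y hy ℓ hℓ
    rcases hy.1 ℓ hℓ with h | h
    · rcases hx₁.1 ℓ hℓ with h' | h'
      · exact .inl (h.trans h'.symm)
      · exact .inr (hz y hy ℓ hℓ h')
    · exact .inr h
  · intro y hy
    have hyP : y ∈ closedSignCell L x₀ := by
      intro ℓ hℓ
      rcases hy ℓ hℓ with h | h
      · rcases hx₁.1 ℓ hℓ with h' | h'
        · exact .inl (h.trans h')
        · rw [h', sign_zero, sign_eq_zero_iff] at h
          exact .inr h
      · exact .inr h
    refine ⟨hyP, le_antisymm (hφ y hyP) ?_⟩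
    have hint : x₁ ∈ interior {x : Fin n → ℝ | ∀ ℓ ∈ L, ℓ x₁ ≠ 0 →
        0 < ℓ x * ℓ x₁} := by
      have : {x : Fin n → ℝ | ∀ ℓ ∈ L, ℓ x₁ ≠ 0 → 0 < ℓ x * ℓ x₁} =
          ⋂ ℓ ∈ L.filter (fun ℓ => ℓ x₁ ≠ 0), {x | 0 < ℓ x * ℓ x₁} := by
        ext x; simp
      rw [IsOpen.interior_eq]
      · intro ℓ _ h
        exact mul_self_pos.2 h
      · rw [this]
        exact isOpen_biInter_finset fun ℓ _ => isOpen_lt continuous_const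
          (ℓ.continuous_of_finiteDimensional.mul continuous_const)
    obtain ⟨t, ht, ht'⟩ : ∃ t : ℝ, 1 < t ∧ AffineMap.lineMap y x₁ t ∈ {x : Fin n → ℝ |
        ∀ ℓ ∈ L, ℓ x₁ ≠ 0 → 0 < ℓ x * ℓ x₁} := by
      have hc : Filter.Tendsto (fun t : ℝ => (AffineMap.lineMap y x₁ t : Fin n → ℝ))
          (nhdsWithin 1 (Set.Ioi 1)) (nhds x₁) := by
        have : Continuous fun t : ℝ => (AffineMap.lineMap y x₁ t : Fin n → ℝ) :=
          AffineMap.lineMap_continuous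
        simpa using (this.tendsto 1).mono_left nhdsWithin_le_nhds
      obtain ⟨t, h1, h2⟩ := ((hc.eventually (mem_interior_iff_mem_nhds.1 hint)).and
        self_mem_nhdsWithin).exists
      exact ⟨t, h2, h1⟩
    have hmem : AffineMap.lineMap y x₁ t ∈ closedSignCell L x₀ := by
      intro ℓ hℓ
      by_cases h0 : ℓ x₁ = 0
      · right
        have hy0 : ℓ y = 0 := by
          rcases hy ℓ hℓ with h | h
          · rwa [h0, sign_zero, sign_eq_zero_iff] at h
          · exact h
        rw [AffineMap.apply_lineMap, h0, hy0]
        simp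
      · rcases hx₁.1 ℓ hℓ with h' | h'
        · left
          have h1 := ht' ℓ hℓ h0
          rw [← h']
          rcases ((sign_eq_or_eq_zero_iff _ _).2 ⟨h1.le, fun h => absurd h h0⟩) with h2 | h2
          · exact h2
          · rw [h2] at h1; simp at h1
        · exact absurd h' h0
    have h1 := hφ _ hmem
    rw [AffineMap.apply_lineMap, hx₁.2, AffineMap.lineMap_apply] at h1
    simp at h1
    nlinarith

theorem isPolyhedralComplex_closedSignCell (L : Finset ((Fin n → ℝ) →ᵃ[ℝ] ℝ)) :
    IsPolyhedralComplex (insert ∅ (Set.range (closedSignCell L))) where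
  isPolyhedron := by
    rintro _ (rfl | ⟨x₀, rfl⟩)
    · exact isPolyhedron_iff.2 ⟨{AffineMap.const ℝ _ 1}, by ext; simp⟩
    · exact isPolyhedron_closedSignCell x₀
  inter_isFaceOf := by
    rintro _ (rfl | ⟨x₀, rfl⟩) _ (rfl | ⟨x₁, rfl⟩)
    · simp [isFaceOf_empty]
    · simp [isFaceOf_empty]
    · simp [isFaceOf_empty]
    · refine ⟨isFaceOf_closedSignCell_inter x₀ x₁, ?_⟩
      rw [Set.inter_comm]
      exact isFaceOf_closedSignCell_inter x₁ x₀
  face_mem := by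
    rintro P hP F hF
    rcases F.eq_empty_or_nonempty with rfl | hne
    · exact .inl rfl
    · rcases hP with rfl | ⟨x₀, rfl⟩
      · obtain ⟨a, c, -, rfl⟩ := hF
        simp at hne
      · obtain ⟨x₁, rfl⟩ := eq_closedSignCell_of_isFaceOf hF hne
        exact .inr ⟨x₁, rfl⟩

/-- If `ℓ x = 0` but `ℓ x₀ ≠ 0`, extending the segment from `x₀` slightly past `x` would flip the
sign of `ℓ` inside the cell. -/
theorem sign_eq_of_mem_intrinsicInterior {x₀ x : Fin n → ℝ}
    (hx : x ∈ intrinsicInterior ℝ (closedSignCell L x₀)) {ℓ : (Fin n → ℝ) →ᵃ[ℝ] ℝ} (hℓ : ℓ ∈ L) :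
    SignType.sign (ℓ x) = SignType.sign (ℓ x₀) := by
  rcases intrinsicInterior_subset hx ℓ hℓ with h | h
  · exact h
  · obtain ⟨t, ht, hm⟩ := exists_lineMap_mem_of_mem_intrinsicInterior hx
      (self_mem_closedSignCell x₀)
    have h1 := ((sign_eq_or_eq_zero_iff _ _).1 (hm ℓ hℓ)).1
    rw [AffineMap.apply_lineMap, h, AffineMap.lineMap_apply] at h1
    simp at h1
    have h0 : ℓ x₀ = 0 := by
      by_contra h0
      have := mul_self_pos.2 h0
      nlinarith
    rw [h, h0]

theorem mem_PWL_iff : f ∈ PWL n ↔ ∃ L, IsAffineOnSignCells L f := by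
  classical
  constructor
  · rintro ⟨K, hfin, hK, hcov, haff⟩
    choose! M hM using fun P (hP : P ∈ K) => isPolyhedron_iff.1 (hK.isPolyhedron P hP)
    refine ⟨hfin.toFinset.biUnion M, fun s => ?_⟩
    by_cases hs : ∃ x₀, ∀ ℓ : hfin.toFinset.biUnion M, SignType.sign (ℓ.1 x₀) = s ℓ
    swap
    · exact ⟨0, fun x hx => absurd ⟨x, hx⟩ hs⟩
    obtain ⟨x₀, hx₀⟩ := hs
    obtain ⟨P₀, hP₀, hx₀P₀⟩ : x₀ ∈ ⋃₀ K := hcov ▸ Set.mem_univ x₀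
    -- For a minimal `P` containing `x₀`, a constraint tight at `x₀` cuts out a face containing
    -- `x₀`, which must be all of `P`. So every point with the signs of `x₀` lies in the relative
    -- interior of `P`.
    obtain ⟨P, hPmin⟩ := (hfin.subset (Set.sep_subset K fun P => x₀ ∈ P)).exists_minimal
      ⟨P₀, hP₀, hx₀P₀⟩
    obtain ⟨hPK, hx₀P⟩ := hPmin.prop
    obtain ⟨g, hg⟩ := haff P hPK
    refine ⟨g, fun x hx => hg ?_⟩
    have hsame : ∀ ℓ ∈ M P, SignType.sign (ℓ x) = SignType.sign (ℓ x₀) := by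
      intro ℓ hℓ
      have hm : ℓ ∈ hfin.toFinset.biUnion M :=
        Finset.mem_biUnion.2 ⟨P, hfin.mem_toFinset.2 hPK, hℓ⟩
      exact (hx ⟨ℓ, hm⟩).trans (hx₀ ⟨ℓ, hm⟩).symm
    have hx₀' : ∀ ℓ ∈ M P, ℓ x₀ ≤ 0 := by
      have := hx₀P
      rwa [hM P hPK] at this
    rw [hM P hPK]
    refine mem_intrinsicInterior_of_forall (fun ℓ hℓ => ?_) (fun ℓ hℓ h0 y hy => ?_)
    · by_contra hpos
      rw [not_le] at hpos
      have := hsame ℓ hℓ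
      rw [sign_pos hpos] at this
      exact (hx₀' ℓ hℓ).not_gt (sign_eq_one_iff.1 this.symm)
    · have hF : IsFaceOf {z ∈ P | ℓ z = 0} P := isFaceOf_iff.2 ⟨ℓ, fun z hz => by
        rw [hM P hPK] at hz
        exact hz ℓ hℓ, rfl⟩
      have h0' : ℓ x₀ = 0 := by
        have := hsame ℓ hℓ
        rw [h0, sign_zero] at this
        exact sign_eq_zero_iff.1 this.symm
      have hle := hPmin.le_of_le ⟨hK.face_mem P hPK _ hF, hx₀P, h0'⟩ (Set.sep_subset _ _)
      have hyP : y ∈ P := by rw [hM P hPK]; exact hy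
      exact (hle hyP).2
  · rintro ⟨L, hL⟩
    refine ⟨_, finite_range_closedSignCell.insert _, isPolyhedralComplex_closedSignCell L, ?_, ?_⟩
    · refine Set.eq_univ_of_forall fun x => ?_
      exact ⟨_, .inr ⟨x, rfl⟩, self_mem_closedSignCell x⟩
    · rintro _ (rfl | ⟨x₀, rfl⟩)
      · exact ⟨0, by simp⟩
      · obtain ⟨g, hg⟩ := hL fun ℓ => SignType.sign (ℓ.1 x₀)
        exact ⟨g, fun x hx => hg x fun ℓ => sign_eq_of_mem_intrinsicInterior hx ℓ.2⟩

end SignCells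

/-! ### Maxima of affine maps -/

section MaxOfAffine

variable {n : ℕ}

/-- The pointwise maximum of a finite set of affine maps. -/
noncomputable def maxOf (s : Finset ((Fin n → ℝ) →ᵃ[ℝ] ℝ)) (x : Fin n → ℝ) : ℝ :=
  sSup ((fun g : (Fin n → ℝ) →ᵃ[ℝ] ℝ => g x) '' s)

variable {s t : Finset ((Fin n → ℝ) →ᵃ[ℝ] ℝ)}

theorem le_maxOf {g : (Fin n → ℝ) →ᵃ[ℝ] ℝ} (hg : g ∈ s) (x : Fin n → ℝ) : g x ≤ maxOf s x :=
  le_csSup (s.finite_toSet.image _).bddAbove ⟨g, hg, rfl⟩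

theorem exists_maxOf_eq (hs : s.Nonempty) (x : Fin n → ℝ) : ∃ g ∈ s, maxOf s x = g x := by
  obtain ⟨g, hg, h⟩ := ((Finset.coe_nonempty.2 hs).image
    (fun g : (Fin n → ℝ) →ᵃ[ℝ] ℝ => g x)).csSup_mem (s.finite_toSet.image _)
  exact ⟨g, hg, h.symm⟩

theorem maxOf_eq {x : Fin n → ℝ} {v : ℝ} (h : ∃ g ∈ s, g x = v) (h' : ∀ g ∈ s, g x ≤ v) :
    maxOf s x = v := by
  obtain ⟨g, hg, rfl⟩ := h
  obtain ⟨g', hg', h2⟩ := exists_maxOf_eq ⟨g, hg⟩ x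
  exact le_antisymm (h2 ▸ h' g' hg') (le_maxOf hg x)

theorem maxOf_singleton (g : (Fin n → ℝ) →ᵃ[ℝ] ℝ) : maxOf {g} = g :=
  funext fun x => maxOf_eq ⟨g, by simp⟩ (by simp)

theorem maxOf_union [DecidableEq ((Fin n → ℝ) →ᵃ[ℝ] ℝ)] (hs : s.Nonempty) (ht : t.Nonempty) :
    maxOf (s ∪ t) = maxOf s ⊔ maxOf t := by
  funext x
  obtain ⟨g, hg, h⟩ := exists_maxOf_eq hs x
  obtain ⟨g', hg', h'⟩ := exists_maxOf_eq ht x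
  refine maxOf_eq ?_ fun k hk => ?_
  · rcases le_total (maxOf s x) (maxOf t x) with hle | hle
    · exact ⟨g', Finset.mem_union_right _ hg', by simp [h', sup_eq_right.2 (h' ▸ hle)]⟩
    · exact ⟨g, Finset.mem_union_left _ hg, by simp [h, sup_eq_left.2 (h ▸ hle)]⟩
  · rcases Finset.mem_union.1 hk with hk | hk
    · exact (le_maxOf hk x).trans le_sup_left
    · exact (le_maxOf hk x).trans le_sup_right

theorem maxOf_image₂_add [DecidableEq ((Fin n → ℝ) →ᵃ[ℝ] ℝ)] (hs : s.Nonempty)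
    (ht : t.Nonempty) : maxOf (Finset.image₂ (· + ·) s t) = maxOf s + maxOf t := by
  funext x
  obtain ⟨g, hg, h⟩ := exists_maxOf_eq hs x
  obtain ⟨g', hg', h'⟩ := exists_maxOf_eq ht x
  refine maxOf_eq ⟨g + g', Finset.mem_image₂_of_mem hg hg', by simp [h, h']⟩ fun k hk => ?_
  obtain ⟨a, ha, b, hb, rfl⟩ := Finset.mem_image₂.1 hk
  exact add_le_add (le_maxOf ha x) (le_maxOf hb x)

/-- More than `n + 1` affine maps on `ℝⁿ` can be split into two nonempty parts such that the first
never lies strictly above the second. -/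
theorem exists_subset_forall_exists_le (hs : n + 1 < s.card) :
    ∃ J ⊆ s, J.Nonempty ∧ (∃ i ∈ s, i ∉ J) ∧
      ∀ x, ∃ j ∈ J, ∃ i ∈ s, i ∉ J ∧ j x ≤ i x := by
  classical
  -- The pairs (linear part, 1) live in dimension `n + 1`. A dependence `c` makes `∑ c g * g x`
  -- constant in `x`, and replacing `c` by `-c` makes this constant nonnegative. The part `J` is
  -- where `c < 0`.
  have hdep : ¬ LinearIndependent ℝ
      (fun g : s => ((g.1.linear, 1) : Module.Dual ℝ (Fin n → ℝ) × ℝ)) := by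
    intro h
    have := h.fintype_card_le_finrank
    simp [Subspace.dual_finrank_eq] at this
    omega
  rw [Fintype.not_linearIndependent_iff] at hdep
  obtain ⟨c₀, hc₀, hne₀⟩ := hdep
  obtain ⟨c, hlin, hsum, ⟨i₀, hi₀⟩, hpos⟩ : ∃ c : s → ℝ,
      (∀ x, ∑ g, c g * g.1.linear x = 0) ∧
      (∑ g, c g = 0) ∧ (∃ i, c i ≠ 0) ∧ 0 ≤ ∑ g, c g * g.1 0 := by
    have h1 : ∀ x, ∑ g, c₀ g * g.1.linear x = 0 := fun x => by
      simpa [Prod.fst_sum, LinearMap.sum_apply] using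
        congrArg (fun p : Module.Dual ℝ (Fin n → ℝ) × ℝ => p.1 x) hc₀
    have h2 : ∑ g, c₀ g = 0 := by simpa [Prod.snd_sum] using congrArg Prod.snd hc₀
    rcases le_total 0 (∑ g, c₀ g * g.1 0) with h | h
    · exact ⟨c₀, h1, h2, hne₀, h⟩
    · exact ⟨-c₀, fun x => by simp only [Pi.neg_apply, neg_mul, Finset.sum_neg_distrib, h1, neg_zero],
        by simp only [Pi.neg_apply, Finset.sum_neg_distrib, h2, neg_zero], by simpa using hne₀, by simpa using h⟩
  have hval : ∀ x, 0 ≤ ∑ g, c g * g.1 x := by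
    intro x
    have h1 : ∀ g : s, g.1 x = g.1.linear x + g.1 0 := fun g => congrFun g.1.decomp x
    simp_rw [h1, mul_add, Finset.sum_add_distrib, hlin]
    simpa using hpos
  have hneg : ∃ j, c j < 0 := by
    by_contra! h
    exact hi₀ ((Finset.sum_eq_zero_iff_of_nonneg fun i _ => h i).1 hsum i₀ (Finset.mem_univ _))
  have hpos' : ∃ j, 0 < c j := by
    by_contra! h
    exact hi₀ ((Finset.sum_eq_zero_iff_of_nonpos fun i _ => h i).1 hsum i₀ (Finset.mem_univ _))
  obtain ⟨j₀, hj₀⟩ := hneg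
  obtain ⟨i₁, hi₁⟩ := hpos'
  have hmem : ∀ i : s, i.1 ∈ (Finset.univ.filter fun j : s => c j < 0).map
      (Function.Embedding.subtype _) ↔ c i < 0 := by
    intro i
    simp
  refine ⟨(Finset.univ.filter fun j : s => c j < 0).map (Function.Embedding.subtype _), ?_,
    ⟨j₀, (hmem j₀).2 hj₀⟩, ⟨i₁, i₁.2, fun h => ((hmem i₁).1 h).not_gt hi₁⟩, fun x => ?_⟩
  · intro g hg
    obtain ⟨j, -, rfl⟩ := Finset.mem_map.1 hg
    exact j.2
  by_contra! hcon
  have hcon' : ∀ j i : s, c j < 0 → ¬ c i < 0 → i.1 x < j.1 x := fun j i hj hi =>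
    hcon j.1 ((hmem j).2 hj) i.1 i.2 (mt (hmem i).1 hi)
  -- Subtracting the largest value `m x` outside `J` leaves the sum unchanged, as the coefficients
  -- sum to zero, but makes every term nonpositive and one negative.
  obtain ⟨m, hm, hmax⟩ := (Finset.univ.filter fun i : s => ¬ c i < 0).exists_max_image
    (fun i => i.1 x) ⟨i₁, by simpa using hi₁.le⟩
  have hm' : ¬ c m < 0 := (Finset.mem_filter.1 hm).2
  have h0 : ∑ g, c g * g.1 x = ∑ g, c g * (g.1 x - m.1 x) := by
    simp_rw [mul_sub, Finset.sum_sub_distrib, ← Finset.sum_mul, hsum]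
    simp
  have hlt : ∑ g, c g * (g.1 x - m.1 x) < ∑ g : s, (0 : ℝ) := by
    refine Finset.sum_lt_sum (fun i _ => ?_) ⟨j₀, Finset.mem_univ _, ?_⟩
    · by_cases hi : c i < 0
      · exact mul_nonpos_of_nonpos_of_nonneg hi.le (sub_nonneg.2 (hcon' i m hi hm').le)
      · exact mul_nonpos_of_nonneg_of_nonpos (not_lt.1 hi)
          (sub_nonpos.2 (hmax i (Finset.mem_filter.2 ⟨Finset.mem_univ _, hi⟩)))
    · exact mul_neg_of_neg_of_pos hj₀ (sub_pos.2 (hcon' j₀ m hj₀ hm'))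
  rw [← h0, Finset.sum_const_zero] at hlt
  exact (hval x).not_gt hlt

/-- At a given `x`, pair `S` with `insert j S`: the map `i` outside `J` dominates `j` there, so both
maxima agree and their signs cancel. The pairing depends on `x`. -/
theorem sum_powerset_maxOf_eq_zero [DecidableEq ((Fin n → ℝ) →ᵃ[ℝ] ℝ)]
    {J : Finset ((Fin n → ℝ) →ᵃ[ℝ] ℝ)}
    (hle : ∀ x, ∃ j ∈ J, ∃ i ∈ s, i ∉ J ∧ j x ≤ i x) :
    ∑ S ∈ J.powerset, (-1 : ℝ) ^ S.card • maxOf (s \ J ∪ S) = 0 := by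
  funext x
  obtain ⟨j, hj, i, hi, hiJ, hji⟩ := hle x
  rw [← Finset.insert_erase hj, Finset.sum_powerset_insert (Finset.notMem_erase _ _),
    Finset.insert_erase hj, ← Finset.sum_add_distrib, Finset.sum_apply]
  refine Finset.sum_eq_zero fun S hS => ?_
  have hjS : j ∉ S := fun h => Finset.notMem_erase _ _ (Finset.mem_powerset.1 hS h)
  have hiS : i ∈ s \ J ∪ S := Finset.mem_union_left _ (Finset.mem_sdiff.2 ⟨hi, hiJ⟩)
  have heq : maxOf (s \ J ∪ insert j S) x = maxOf (s \ J ∪ S) x := by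
    obtain ⟨g, hg, h⟩ := exists_maxOf_eq ⟨i, hiS⟩ x
    rw [Finset.union_insert]
    refine maxOf_eq ⟨g, Finset.mem_insert_of_mem hg, h.symm⟩ fun k hk => ?_
    rcases Finset.mem_insert.1 hk with rfl | hk
    · exact hji.trans (le_maxOf hiS x)
    · exact le_maxOf hk x
  simp only [Finset.card_insert_of_notMem hjS, Pi.add_apply, Pi.smul_apply, heq, pow_succ,
    smul_eq_mul]
  simp

/-- Every maximum of affine maps on `ℝⁿ` is a linear combination of maxima of at most `n + 1`
affine maps. -/
theorem maxOf_mem_of_forall_card_le {V : Submodule ℝ ((Fin n → ℝ) → ℝ)}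
    (hV : ∀ t : Finset ((Fin n → ℝ) →ᵃ[ℝ] ℝ), t.Nonempty → t.card ≤ n + 1 → maxOf t ∈ V)
    (s : Finset ((Fin n → ℝ) →ᵃ[ℝ] ℝ)) (hs : s.Nonempty) : maxOf s ∈ V := by
  classical
  induction s using Finset.strongInduction with
  | H s ih =>
    rcases le_or_gt s.card (n + 1) with hc | hc
    · exact hV s hs hc
    obtain ⟨J, hJs, hJ, ⟨i, hi, hiJ⟩, hle⟩ := exists_subset_forall_exists_le hc
    have hzero := sum_powerset_maxOf_eq_zero hle
    -- The term `S = J` is `maxOf s` up to sign; all others involve proper subsets of `s`.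
    rw [← Finset.sum_erase_add _ _ (Finset.mem_powerset_self J),
      Finset.sdiff_union_of_subset hJs] at hzero
    have hmem : ∑ S ∈ J.powerset.erase J, (-1 : ℝ) ^ S.card • maxOf (s \ J ∪ S) ∈ V := by
      refine V.sum_mem fun S hS => V.smul_mem _ (ih _ ?_ ?_)
      · obtain ⟨hne, hSJ⟩ := Finset.mem_erase.1 hS
        rw [Finset.mem_powerset] at hSJ
        obtain ⟨j, hj, hjS⟩ := Finset.exists_of_ssubset (hSJ.ssubset_of_ne hne)
        refine Finset.ssubset_iff_of_subset (Finset.union_subset Finset.sdiff_subset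
          (hSJ.trans hJs)) |>.2 ⟨j, hJs hj, ?_⟩
        simp [hj, hjS]
      · exact ⟨i, Finset.mem_union_left _ (Finset.mem_sdiff.2 ⟨hi, hiJ⟩)⟩
    rw [eq_neg_of_add_eq_zero_left hzero, V.neg_mem_iff] at hmem
    exact (V.smul_mem_iff (pow_ne_zero _ (by norm_num))).1 hmem

/-- `f` is a difference of two maxima of affine maps. -/
def IsMaxAffineDiff (f : (Fin n → ℝ) → ℝ) : Prop :=
  ∃ s t : Finset ((Fin n → ℝ) →ᵃ[ℝ] ℝ), s.Nonempty ∧ t.Nonempty ∧ f = maxOf s - maxOf t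

/-! ### Differences of maxima and continuous selections -/

theorem isMaxAffineDiff_affineMap (g : (Fin n → ℝ) →ᵃ[ℝ] ℝ) : IsMaxAffineDiff g :=
  ⟨{g}, {0}, by simp, by simp, by simp [maxOf_singleton]⟩

theorem IsMaxAffineDiff.neg {f : (Fin n → ℝ) → ℝ} (hf : IsMaxAffineDiff f) :
    IsMaxAffineDiff (-f) := by
  obtain ⟨s, t, hs, ht, rfl⟩ := hf
  exact ⟨t, s, ht, hs, by simp⟩

theorem IsMaxAffineDiff.sup {f g : (Fin n → ℝ) → ℝ} (hf : IsMaxAffineDiff f)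
    (hg : IsMaxAffineDiff g) : IsMaxAffineDiff (f ⊔ g) := by
  classical
  obtain ⟨s, t, hs, ht, rfl⟩ := hf
  obtain ⟨s', t', hs', ht', rfl⟩ := hg
  -- `max (a - b) (a' - b') = max (a + b') (a' + b) - (b + b')`.
  refine ⟨Finset.image₂ (· + ·) s t' ∪ Finset.image₂ (· + ·) s' t, Finset.image₂ (· + ·) t t',
    (hs.image₂ ht').mono Finset.subset_union_left, ht.image₂ ht', ?_⟩
  rw [maxOf_union (hs.image₂ ht') (hs'.image₂ ht), maxOf_image₂_add hs ht',
    maxOf_image₂_add hs' ht, maxOf_image₂_add ht ht']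
  funext x
  simp only [Pi.sup_apply, Pi.sub_apply, Pi.add_apply]
  rw [← max_sub_sub_right]
  congr 1 <;> ring

theorem IsMaxAffineDiff.inf {f g : (Fin n → ℝ) → ℝ} (hf : IsMaxAffineDiff f)
    (hg : IsMaxAffineDiff g) : IsMaxAffineDiff (f ⊓ g) := by
  rw [← neg_neg (f ⊓ g), neg_inf]
  exact (hf.neg.sup hg.neg).neg

/-- If a continuous function on `[0, 1]` vanishing at both ends is a selection from finitely many
affine functions `t ↦ u i + t * v i`, one of these is nonpositive at `0` and nonnegative at
`1`. -/
theorem exists_nonpos_nonneg_of_selection {ι : Type*} (G : Finset ι) (u v : ι → ℝ) {φ : ℝ → ℝ}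
    (hφ : Continuous φ) (h0 : φ 0 = 0) (h1 : φ 1 = 0)
    (hsel : ∀ t, ∃ i ∈ G, φ t = u i + t * v i) :
    ∃ i ∈ G, u i ≤ 0 ∧ 0 ≤ u i + v i := by
  by_contra! hcon
  -- By continuity, a piece active close enough to `t` is already active at `t`.
  have hnear : ∀ t, ∀ᶠ r in nhds t, ∃ i ∈ G, φ r = u i + r * v i ∧ φ t = u i + t * v i := by
    intro t
    have : ∀ i ∈ G, ∀ᶠ r in nhds t, φ r = u i + r * v i → φ t = u i + t * v i := by
      intro i _
      by_cases hi : φ t = u i + t * v i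
      · exact Filter.Eventually.of_forall fun _ _ => hi
      · have hc : Continuous fun r => φ r - (u i + r * v i) := by fun_prop
        filter_upwards [hc.continuousAt.eventually_ne (sub_ne_zero.2 hi)] with r hr h
        exact absurd (sub_eq_zero.2 h) hr
    filter_upwards [(G.eventually_all).2 this] with r hr
    obtain ⟨i, hi, h⟩ := hsel r
    exact ⟨i, hi, h, hr i hi h⟩
  -- Continuous induction: a piece vanishing at `t < 1` with positive slope would satisfy `u ≤ 0 ≤ u
  -- + v`, so `φ` cannot become positive.
  have hle : Set.Icc (0 : ℝ) 1 ⊆ {t | φ t ≤ 0} := by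
    refine IsClosed.Icc_subset_of_forall_mem_nhdsWithin
      ((isClosed_le hφ continuous_const).inter isClosed_Icc) h0.le ?_
    rintro t ⟨ht, ht0, ht1⟩
    rcases (show φ t ≤ 0 from ht).lt_or_eq with h | h
    · exact mem_nhdsWithin_of_mem_nhds
        (Filter.mem_of_superset ((isOpen_lt hφ continuous_const).mem_nhds h)
          fun r (hr : φ r < 0) => show φ r ≤ 0 from hr.le)
    · filter_upwards [mem_nhdsWithin_of_mem_nhds (hnear t), self_mem_nhdsWithin] with r hr htr
      obtain ⟨i, hi, hr, hti⟩ := hr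
      have hv : v i ≤ 0 := by
        by_contra! hv
        have := hcon i hi (by nlinarith)
        nlinarith
      have : t < r := htr
      nlinarith
  -- A piece active at `1` and just before has `u + v = 0`, hence `u > 0` and `φ r = u * (1 - r) >
  -- 0`, a contradiction.
  obtain ⟨r, hr, hr1⟩ := (((hnear 1).filter_mono nhdsWithin_le_nhds).and
    (Ioo_mem_nhdsLT (zero_lt_one' ℝ))).exists
  obtain ⟨i, hi, hri, h1i⟩ := hr
  have hu : 0 < u i := by
    by_contra! h
    have := hcon i hi h
    linarith
  have : φ r ≤ 0 := hle ⟨hr1.1.le, hr1.2.le⟩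
  nlinarith [hr1.2]

/-- Restrict `f` to the line through `a` and `b` and subtract the chord. -/
theorem exists_le_and_ge_of_selection {G : Finset ((Fin n → ℝ) →ᵃ[ℝ] ℝ)} {f : (Fin n → ℝ) → ℝ}
    (hf : Continuous f) (hsel : ∀ x, ∃ g ∈ G, f x = g x) (a b : Fin n → ℝ) :
    ∃ g ∈ G, g a ≤ f a ∧ f b ≤ g b := by
  obtain ⟨g, hg, h1, h2⟩ := exists_nonpos_nonneg_of_selection G (fun g => g a - f a)
    (fun g => (g b - f b) - (g a - f a))
    (φ := fun t => f (AffineMap.lineMap a b t) - (f a + t * (f b - f a)))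
    ((hf.comp AffineMap.lineMap_continuous).sub (by fun_prop)) (by simp) (by simp) (by
      intro t
      obtain ⟨g, hg, h⟩ := hsel (AffineMap.lineMap a b t)
      refine ⟨g, hg, ?_⟩
      rw [h, AffineMap.apply_lineMap, AffineMap.lineMap_apply]
      simp
      ring)
  exact ⟨g, hg, by linarith, by linarith⟩

/-- A continuous selection from finitely many affine maps is a difference of two maxima of affine
maps. -/
theorem isMaxAffineDiff_of_selection {G : Finset ((Fin n → ℝ) →ᵃ[ℝ] ℝ)} {f : (Fin n → ℝ) → ℝ}
    (hf : Continuous f) (hsel : ∀ x, ∃ g ∈ G, f x = g x) : IsMaxAffineDiff f := by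
  classical
  let Φ : (Fin n → ℝ) → Finset ((Fin n → ℝ) →ᵃ[ℝ] ℝ) := fun b => G.filter fun g => f b ≤ g b
  have hΦ : ∀ b, (Φ b).Nonempty := fun b =>
    let ⟨g, hg, h⟩ := hsel b
    ⟨g, Finset.mem_filter.2 ⟨hg, h.le⟩⟩
  have hfin : (Set.range Φ).Finite := G.powerset.finite_toSet.subset (by
    rintro _ ⟨b, rfl⟩
    exact Finset.mem_coe.2 (Finset.mem_powerset.2 (Finset.filter_subset _ _)))
  have : Fintype (Set.range Φ) := hfin.fintype
  have hne : (Finset.univ : Finset (Set.range Φ)).Nonempty := ⟨⟨Φ 0, 0, rfl⟩, Finset.mem_univ _⟩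
  have hSne : ∀ S : Set.range Φ, S.1.Nonempty := by
    rintro ⟨_, b, rfl⟩
    exact hΦ b
  -- At `x`, the set `Φ x` gives a minimum at least `f x`; every `Φ b` contains a map at most `f x`
  -- at `x`, by the segment lemma.
  have hrep : f = Finset.univ.sup' hne fun S : Set.range Φ =>
      S.1.inf' (hSne S) fun g => (g : (Fin n → ℝ) → ℝ) := by
    funext x
    rw [Finset.sup'_apply]
    refine le_antisymm ?_ (Finset.sup'_le _ _ fun S _ => ?_)
    · refine Finset.le_sup'_of_le _ (Finset.mem_univ ⟨Φ x, x, rfl⟩) ?_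
      rw [Finset.inf'_apply]
      exact Finset.le_inf' _ _ fun g hg => (Finset.mem_filter.1 hg).2
    · obtain ⟨_, b, rfl⟩ := S
      obtain ⟨g, hg, h1, h2⟩ := exists_le_and_ge_of_selection hf hsel x b
      rw [Finset.inf'_apply]
      exact (Finset.inf'_le _ (Finset.mem_filter.2 ⟨hg, h2⟩)).trans h1
  rw [hrep]
  refine Finset.sup'_induction _ _ (fun _ h _ h' => h.sup h') fun S _ => ?_
  exact Finset.inf'_induction _ _ (fun _ h _ h' => h.inf h') fun g _ =>
    isMaxAffineDiff_affineMap g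

end MaxOfAffine

/-! ### Functions computed by networks -/

section Networks

variable {n k : ℕ} {σ : ℝ → ℝ}

/-- The `i`-th coordinate as an affine map. -/
abbrev coordAffineMap {w : ℕ} (i : Fin w) : (Fin w → ℝ) →ᵃ[ℝ] ℝ :=
  (LinearMap.proj i : (Fin w → ℝ) →ₗ[ℝ] ℝ).toAffineMap

/-- The networks run in parallel. Projections are kept as matrices so that output and shortcut
weights can be pulled back along them. -/
theorem HiddenLayers.exists_merge (σ : ℝ → ℝ) {k w₁ w₂ : ℕ} (H₁ : HiddenLayers n k w₁)
    (H₂ : HiddenLayers n k w₂) :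
    ∃ (w : ℕ) (H : HiddenLayers n k w) (P₁ : Matrix (Fin w₁) (Fin w) ℝ)
      (P₂ : Matrix (Fin w₂) (Fin w) ℝ),
      (∀ x, H₁.eval σ x = P₁ *ᵥ H.eval σ x) ∧ ∀ x, H₂.eval σ x = P₂ *ᵥ H.eval σ x := by
  induction k generalizing w₁ w₂ with
  | zero =>
    cases H₁
    cases H₂
    exact ⟨n, .input, 1, 1, by simp, by simp⟩
  | succ k ih =>
    cases H₁ with
    | layer H₁ T₁ =>
    cases H₂ with
    | layer H₂ T₂ =>
    obtain ⟨w, H, P₁, P₂, h₁, h₂⟩ := ih H₁ H₂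
    let T : (Fin w → ℝ) →ᵃ[ℝ] (Fin (w₁ + w₂) → ℝ) :=
      AffineMap.pi (Fin.append (fun i => (coordAffineMap i).comp
        (T₁.comp P₁.mulVecLin.toAffineMap)) (fun i => (coordAffineMap i).comp
        (T₂.comp P₂.mulVecLin.toAffineMap)))
    refine ⟨w₁ + w₂, H.layer T, (1 : Matrix _ _ ℝ).submatrix (Fin.castAdd w₂) id,
      (1 : Matrix _ _ ℝ).submatrix (Fin.natAdd w₁) id, fun x => ?_, fun x => ?_⟩
    · ext i
      simp [HiddenLayers.eval, Matrix.mulVec, dotProduct, Matrix.one_apply, T, h₁]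
    · ext i
      simp [HiddenLayers.eval, Matrix.mulVec, dotProduct, Matrix.one_apply, T, h₂]

/-- The functions computed by networks with `k` hidden layers and activation `σ`. -/
def networkFunctions (σ : ℝ → ℝ) (n k : ℕ) : Submodule ℝ ((Fin n → ℝ) → ℝ) where
  carrier := {f | ∃ (w : ℕ) (H : HiddenLayers n k w) (T : (Fin w → ℝ) →ᵃ[ℝ] ℝ),
    ∀ x, f x = T (H.eval σ x)}
  add_mem' := by
    rintro f g ⟨w₁, H₁, T₁, h₁⟩ ⟨w₂, H₂, T₂, h₂⟩
    obtain ⟨w, H, P₁, P₂, hP₁, hP₂⟩ := H₁.exists_merge σ H₂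
    exact ⟨w, H, T₁.comp P₁.mulVecLin.toAffineMap + T₂.comp P₂.mulVecLin.toAffineMap,
      fun x => by simp [h₁, h₂, hP₁, hP₂]⟩
  zero_mem' := by
    have : ∀ k, ∃ w, Nonempty (HiddenLayers n k w) := by
      intro k
      induction k with
      | zero => exact ⟨n, ⟨.input⟩⟩
      | succ k ih =>
        obtain ⟨w, ⟨H⟩⟩ := ih
        exact ⟨0, ⟨H.layer 0⟩⟩
    obtain ⟨w, ⟨H⟩⟩ := this k
    exact ⟨w, H, 0, by simp⟩
  smul_mem' := by
    rintro c f ⟨w, H, T, h⟩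
    exact ⟨w, H, c • T, by simp [h]⟩

theorem affineMap_mem_networkFunctions_zero (g : (Fin n → ℝ) →ᵃ[ℝ] ℝ) :
    ⇑g ∈ networkFunctions σ n 0 :=
  ⟨n, .input, g, fun _ => rfl⟩

theorem const_mem_networkFunctions (c : ℝ) : (fun _ => c) ∈ networkFunctions σ n k := by
  obtain ⟨w, H, T, -⟩ := (networkFunctions σ n k).zero_mem
  exact ⟨w, H, AffineMap.const ℝ _ c, by simp⟩

theorem exists_hiddenLayers_eval_eq {f : (Fin n → ℝ) → ℝ} (hf : f ∈ networkFunctions σ n k) :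
    ∃ H : HiddenLayers n (k + 1) 1, ∀ x, H.eval σ x = fun _ => σ (f x) := by
  obtain ⟨w, H, T, h⟩ := hf
  exact ⟨H.layer (AffineMap.pi fun _ => T), fun x => by ext; simp [HiddenLayers.eval, h]⟩

theorem activation_comp_mem_networkFunctions {f : (Fin n → ℝ) → ℝ}
    (hf : f ∈ networkFunctions σ n k) : (fun x => σ (f x)) ∈ networkFunctions σ n (k + 1) := by
  obtain ⟨H, hH⟩ := exists_hiddenLayers_eval_eq hf
  exact ⟨1, H, (coordAffineMap 0), by simp [hH]⟩

theorem mem_ReLUClass_iff {f : (Fin n → ℝ) → ℝ} :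
    f ∈ ReLUClass n k ↔ f ∈ networkFunctions reluActivation n k := by
  constructor
  · rintro ⟨N, hN⟩
    exact ⟨N.width, N.hidden, (coordAffineMap 0).comp N.output, hN⟩
  · rintro ⟨w, H, T, h⟩
    exact ⟨⟨w, H, AffineMap.pi fun _ => T⟩, h⟩

/-- Uses `t = max 0 t - max 0 (-t)`. -/
theorem mem_networkFunctions_relu_succ {f : (Fin n → ℝ) → ℝ}
    (hf : f ∈ networkFunctions reluActivation n k) :
    f ∈ networkFunctions reluActivation n (k + 1) := by
  have h := Submodule.sub_mem _ (activation_comp_mem_networkFunctions hf)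
    (activation_comp_mem_networkFunctions (Submodule.neg_mem _ hf))
  convert h using 1
  funext x
  simp only [reluActivation, Pi.sub_apply, Pi.neg_apply]
  rcases le_total (f x) 0 with h | h <;> simp [h]

/-- Uses `max a b = a + max 0 (b - a)`. -/
theorem sup_mem_networkFunctions_relu {f g : (Fin n → ℝ) → ℝ}
    (hf : f ∈ networkFunctions reluActivation n k) (hg : g ∈ networkFunctions reluActivation n k) :
    f ⊔ g ∈ networkFunctions reluActivation n (k + 1) := by
  have h := Submodule.add_mem _ (mem_networkFunctions_relu_succ hf)
    (activation_comp_mem_networkFunctions (Submodule.sub_mem _ hg hf))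
  convert h using 1
  funext x
  simp only [reluActivation, Pi.sub_apply, Pi.add_apply, Pi.sup_apply]
  rcases le_total (f x) (g x) with h | h <;> simp [h]

theorem maxOf_mem_networkFunctions_relu (s : Finset ((Fin n → ℝ) →ᵃ[ℝ] ℝ)) (hs : s.Nonempty)
    (hc : s.card ≤ 2 ^ k) : maxOf s ∈ networkFunctions reluActivation n k := by
  classical
  induction k generalizing s with
  | zero =>
    obtain ⟨g, rfl⟩ := Finset.card_eq_one.1 (le_antisymm (by simpa using hc) hs.card_pos)
    rw [maxOf_singleton]
    exact affineMap_mem_networkFunctions_zero g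
  | succ k ih =>
    rcases le_or_gt s.card (2 ^ k) with h | h
    · exact mem_networkFunctions_relu_succ (ih s hs h)
    · obtain ⟨t, hts, ht⟩ := Finset.exists_subset_card_eq h.le
      have hcard := Finset.card_sdiff_add_card_eq_card hts
      have ht0 : t.Nonempty := Finset.card_pos.1 (by rw [ht]; positivity)
      have hst : (s \ t).Nonempty := Finset.card_pos.1 (by omega)
      rw [← Finset.sdiff_union_of_subset hts, maxOf_union hst ht0]
      exact sup_mem_networkFunctions_relu (ih _ hst (by rw [pow_succ] at hc; omega))
        (ih _ ht0 ht.le)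

/-! ### Closure properties of piecewise linear functions and the ReLU equality -/

section SignCellClosure

variable {L M : Finset ((Fin n → ℝ) →ᵃ[ℝ] ℝ)} {f g : (Fin n → ℝ) → ℝ}

theorem IsAffineOnSignCells.mono (hf : IsAffineOnSignCells L f) (h : L ⊆ M) :
    IsAffineOnSignCells M f := fun s =>
  let ⟨g, hg⟩ := hf fun ℓ => s ⟨ℓ, h ℓ.2⟩
  ⟨g, fun x hx => hg x fun ℓ => hx ⟨ℓ, h ℓ.2⟩⟩

theorem isAffineOnSignCells_affineMap (g : (Fin n → ℝ) →ᵃ[ℝ] ℝ) : IsAffineOnSignCells L g :=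
  fun _ => ⟨g, fun _ _ => rfl⟩

/-- The piecewise linear functions form a linear subspace. -/
def pwlSubmodule (n : ℕ) : Submodule ℝ ((Fin n → ℝ) → ℝ) where
  carrier := PWL n
  add_mem' := by
    classical
    intro f g hf hg
    obtain ⟨L, hL⟩ := mem_PWL_iff.1 hf
    obtain ⟨M, hM⟩ := mem_PWL_iff.1 hg
    refine mem_PWL_iff.2 ⟨L ∪ M, fun s => ?_⟩
    obtain ⟨f', hf'⟩ := hL.mono (Finset.subset_union_left (s₂ := M)) s
    obtain ⟨g', hg'⟩ := hM.mono (Finset.subset_union_right (s₁ := L)) s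
    exact ⟨f' + g', fun x hx => by simp [hf' x hx, hg' x hx]⟩
  zero_mem' := mem_PWL_iff.2 ⟨∅, isAffineOnSignCells_affineMap 0⟩
  smul_mem' := by
    intro c f hf
    obtain ⟨L, hL⟩ := mem_PWL_iff.1 hf
    refine mem_PWL_iff.2 ⟨L, fun s => ?_⟩
    obtain ⟨f', hf'⟩ := hL s
    exact ⟨c • f', fun x hx => by simp [hf' x hx]⟩

theorem affineMap_mem_PWL (g : (Fin n → ℝ) →ᵃ[ℝ] ℝ) : ⇑g ∈ PWL n :=
  mem_PWL_iff.2 ⟨∅, isAffineOnSignCells_affineMap g⟩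

theorem relu_comp_mem_PWL (hf : f ∈ PWL n) : (fun x => reluActivation (f x)) ∈ PWL n := by
  classical
  obtain ⟨L, hL⟩ := mem_PWL_iff.1 hf
  choose g hg using hL
  -- Adding the affine pieces of `f` to `L` fixes the sign of `f` on each cell.
  refine mem_PWL_iff.2 ⟨L ∪ Finset.univ.image g, fun s => ?_⟩
  let s' : L → SignType := fun ℓ => s ⟨ℓ, Finset.mem_union_left _ ℓ.2⟩
  have hmem : g s' ∈ L ∪ Finset.univ.image g :=
    Finset.mem_union_right _ (Finset.mem_image_of_mem g (Finset.mem_univ s'))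
  refine ⟨if s ⟨g s', hmem⟩ = 1 then g s' else 0, fun x hx => ?_⟩
  have h1 := hx ⟨g s', hmem⟩
  beta_reduce
  rw [hg s' x fun ℓ => hx ⟨ℓ, _⟩, ← h1]
  split_ifs with h
  · exact max_eq_right (sign_eq_one_iff.1 h).le
  · exact max_eq_left (not_lt.1 (mt sign_eq_one_iff.2 h))

theorem affineMap_comp_mem_PWL {w : ℕ} {u : (Fin n → ℝ) → Fin w → ℝ}
    (hu : ∀ i, (fun x => u x i) ∈ PWL n) (T : (Fin w → ℝ) →ᵃ[ℝ] ℝ) :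
    (fun x => T (u x)) ∈ PWL n := by
  obtain ⟨a, c, h⟩ := exists_forall_eq_dotProduct_sub T
  have := (pwlSubmodule n).sub_mem
    ((pwlSubmodule n).sum_mem fun i (_ : i ∈ Finset.univ) => (pwlSubmodule n).smul_mem (a i) (hu i))
    (affineMap_mem_PWL (AffineMap.const ℝ _ c))
  have heq : (fun x => T (u x)) =
      (∑ i, a i • fun x => u x i) - ⇑(AffineMap.const ℝ (Fin n → ℝ) c) := by
    funext x
    simp [h, dotProduct]
  rw [heq]
  exact this

theorem relu_hiddenLayers_mem_CPWL {w : ℕ} (H : HiddenLayers n k w) (i : Fin w) :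
    (fun x => H.eval reluActivation x i) ∈ CPWL n := by
  induction H with
  | input =>
    exact ⟨affineMap_mem_PWL (coordAffineMap i), continuous_apply i⟩
  | layer H T ih =>
    refine ⟨relu_comp_mem_PWL (affineMap_comp_mem_PWL (fun j => (ih j).1)
      ((coordAffineMap i).comp T)), ?_⟩
    exact continuous_const.max ((continuous_apply i).comp
      (T.continuous_of_finiteDimensional.comp (continuous_pi fun j => (ih j).2)))

theorem networkFunctions_relu_subset_CPWL : (networkFunctions reluActivation n k : Set _) ⊆
    CPWL n := by
  rintro f ⟨w, H, T, h⟩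
  obtain rfl : f = fun x => T (H.eval reluActivation x) := funext h
  exact ⟨affineMap_comp_mem_PWL (fun j => (relu_hiddenLayers_mem_CPWL H j).1) T,
    T.continuous_of_finiteDimensional.comp
      (continuous_pi fun j => (relu_hiddenLayers_mem_CPWL H j).2)⟩

theorem isMaxAffineDiff_of_mem_CPWL (hf : f ∈ CPWL n) : IsMaxAffineDiff f := by
  classical
  obtain ⟨L, hL⟩ := mem_PWL_iff.1 hf.1
  choose g hg using hL
  exact isMaxAffineDiff_of_selection (G := Finset.univ.image g) hf.2 fun x =>
    ⟨_, Finset.mem_image_of_mem g (Finset.mem_univ fun ℓ => SignType.sign (ℓ.1 x)),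
      hg _ x fun _ => rfl⟩

theorem CPWL_subset_networkFunctions_relu (hk : n + 1 ≤ 2 ^ k) :
    CPWL n ⊆ networkFunctions reluActivation n k := by
  intro f hf
  obtain ⟨s, t, hs, ht, rfl⟩ := isMaxAffineDiff_of_mem_CPWL hf
  have hV := maxOf_mem_of_forall_card_le fun (t : Finset ((Fin n → ℝ) →ᵃ[ℝ] ℝ)) ht hc =>
    maxOf_mem_networkFunctions_relu (k := k) t ht (hc.trans hk)
  exact Submodule.sub_mem _ (hV s hs) (hV t ht)

theorem ReLUClass_eq_CPWL (hk : n + 1 ≤ 2 ^ k) : ReLUClass n k = CPWL n := by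
  ext f
  rw [mem_ReLUClass_iff]
  exact ⟨fun h => networkFunctions_relu_subset_CPWL h,
    fun h => CPWL_subset_networkFunctions_relu hk h⟩

/-! ### Threshold networks -/

theorem thresholdActivation_eq (t : ℝ) :
    thresholdActivation t = if SignType.sign t = 1 then 1 else 0 := by
  simp [thresholdActivation, sign_eq_one_iff]

theorem exists_mem_networkFunctions_threshold (ℓ : (Fin n → ℝ) →ᵃ[ℝ] ℝ) (s : SignType) :
    (fun x => if SignType.sign (ℓ x) = s then (0 : ℝ) else -1) ∈
      networkFunctions thresholdActivation n 1 := by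
  have hp := activation_comp_mem_networkFunctions (σ := thresholdActivation)
    (affineMap_mem_networkFunctions_zero ℓ)
  have hn := activation_comp_mem_networkFunctions (σ := thresholdActivation)
    (affineMap_mem_networkFunctions_zero (-ℓ))
  have h1 := const_mem_networkFunctions (σ := thresholdActivation) (n := n) (k := 1) 1
  have key : ∀ x, (ℓ x < 0 ∨ ℓ x = 0 ∨ 0 < ℓ x) := fun x => lt_trichotomy _ _
  cases s with
  | zero =>
    convert Submodule.neg_mem _ (Submodule.add_mem _ hp hn) using 1
    funext x
    rcases key x with h | h | h <;> simp [thresholdActivation, h, h.le, not_lt.2]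
  | neg =>
    convert Submodule.sub_mem _ hn h1 using 1
    funext x
    rcases key x with h | h | h <;> simp [thresholdActivation, h, h.le, not_lt.2]
  | pos =>
    convert Submodule.sub_mem _ hp h1 using 1
    funext x
    rcases key x with h | h | h <;> simp [thresholdActivation, h, h.le, not_lt.2]

/-- Each wrong sign costs a penalty of `-1`, so `1 / 2` plus the penalties is positive exactly when
all signs match: one threshold unit computes the conjunction. -/
theorem exists_hiddenLayers_eval_eq_indicator (L : Finset ((Fin n → ℝ) →ᵃ[ℝ] ℝ))
    (s : L → SignType) : ∃ H : HiddenLayers n 2 1, ∀ x, H.eval thresholdActivation x =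
      fun _ => if ∀ ℓ : L, SignType.sign (ℓ.1 x) = s ℓ then 1 else 0 := by
  classical
  have hmem := Submodule.add_mem _
    (const_mem_networkFunctions (σ := thresholdActivation) (n := n) (k := 1) (1 / 2))
    (Submodule.sum_mem _ fun ℓ (_ : ℓ ∈ Finset.univ) =>
      exists_mem_networkFunctions_threshold (ℓ : L).1 (s ℓ))
  obtain ⟨H, hH⟩ := exists_hiddenLayers_eval_eq hmem
  refine ⟨H, fun x => (hH x).trans (funext fun _ => ?_)⟩
  simp only [Pi.add_apply, Finset.sum_apply, thresholdActivation]
  by_cases h : ∀ ℓ : L, SignType.sign (ℓ.1 x) = s ℓ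
  · rw [if_pos h, if_pos]
    simp [h]
  · rw [if_neg h, if_neg]
    obtain ⟨ℓ₀, hℓ₀⟩ := not_forall.1 h
    rw [not_lt, ← Finset.add_sum_erase _ _ (Finset.mem_univ ℓ₀), if_neg hℓ₀]
    have : ∑ ℓ ∈ Finset.univ.erase ℓ₀, (if SignType.sign (ℓ.1 x) = s ℓ then (0 : ℝ) else -1) ≤ 0 :=
      Finset.sum_nonpos fun ℓ _ => by split_ifs <;> norm_num
    linarith

theorem add_mem_SLTClass (hf : f ∈ SLTClass n k) (hg : g ∈ SLTClass n k) :
    f + g ∈ SLTClass n k := by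
  obtain ⟨⟨w₁, H₁, A₁, b₁⟩, h₁⟩ := hf
  obtain ⟨⟨w₂, H₂, A₂, b₂⟩, h₂⟩ := hg
  obtain ⟨w, H, P₁, P₂, hP₁, hP₂⟩ := H₁.exists_merge thresholdActivation H₂
  refine ⟨⟨w, H, A₁ * P₁ + A₂ * P₂, b₁ ᵥ* P₁ + b₂ ᵥ* P₂⟩, fun x => ?_⟩
  simp only [Pi.add_apply, h₁, h₂, ShortcutNetwork.eval, hP₁, hP₂, Matrix.dotProduct_mulVec,
    ← add_dotProduct, Matrix.mulVec_transpose, Matrix.add_vecMul, Matrix.vecMul_add,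
    Matrix.vecMul_vecMul]
  congr 1
  abel

theorem affineMap_mul_indicator_mem_SLTClass (L : Finset ((Fin n → ℝ) →ᵃ[ℝ] ℝ))
    (s : L → SignType) (g : (Fin n → ℝ) →ᵃ[ℝ] ℝ) :
    (fun x => if ∀ ℓ : L, SignType.sign (ℓ.1 x) = s ℓ then g x else 0) ∈ SLTClass n 2 := by
  obtain ⟨H, hH⟩ := exists_hiddenLayers_eval_eq_indicator L s
  obtain ⟨a, c, hg⟩ := exists_forall_eq_dotProduct_sub g
  refine ⟨⟨1, H, Matrix.of fun i _ => a i, fun _ => -c⟩, fun x => ?_⟩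
  simp only [ShortcutNetwork.eval, hH, dotProduct, Finset.univ_unique, Finset.sum_singleton,
    Pi.add_apply, Matrix.mulVec, Matrix.transpose_apply, Matrix.of_apply, hg]
  split_ifs <;> ring

theorem PWL_subset_SLTClass : PWL n ⊆ SLTClass n 2 := by
  classical
  intro f hf
  obtain ⟨L, hL⟩ := mem_PWL_iff.1 hf
  choose g hg using hL
  -- Exactly one sign pattern matches each `x`, so a single summand survives.
  have heq : f = ∑ s : L → SignType, fun x =>
      if ∀ ℓ : L, SignType.sign (ℓ.1 x) = s ℓ then g s x else 0 := by
    funext x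
    rw [Finset.sum_apply, Finset.sum_eq_single fun ℓ => SignType.sign (ℓ.1 x)]
    · rw [if_pos fun _ => rfl]
      exact hg _ x fun _ => rfl
    · intro s _ hs
      rw [if_neg fun h => hs (funext fun ℓ => (h ℓ).symm)]
    · simp
  rw [heq]
  refine Finset.sum_induction_nonempty _ (· ∈ SLTClass n 2) (fun _ _ => add_mem_SLTClass)
    Finset.univ_nonempty fun s _ => affineMap_mul_indicator_mem_SLTClass L s (g s)

theorem SLTClass_subset_PWL : SLTClass n 2 ⊆ PWL n := by
  classical
  rintro f ⟨⟨w, H, A, b⟩, hf⟩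
  cases H with
  | layer H T₂ =>
  cases H with
  | layer H T₁ =>
  cases H
  let p : Fin _ → ((Fin n → ℝ) →ᵃ[ℝ] ℝ) := fun i => (coordAffineMap i).comp T₁
  refine mem_PWL_iff.2 ⟨Finset.univ.image p, fun s => ?_⟩
  let y : Fin _ → ℝ := fun i =>
    if s ⟨p i, Finset.mem_image_of_mem p (Finset.mem_univ i)⟩ = 1 then 1 else 0
  let z : Fin w → ℝ := fun j => thresholdActivation (T₂ y j)
  obtain ⟨g, hg⟩ := exists_affineMap_eq_dotProduct_sub (A *ᵥ z) (-(b ⬝ᵥ z))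
  refine ⟨g, fun x hx => ?_⟩
  have h1 : (HiddenLayers.input.layer T₁).eval thresholdActivation x = y := by
    funext i
    simp only [HiddenLayers.eval, thresholdActivation_eq, y]
    rw [← hx ⟨p i, _⟩]
    rfl
  rw [hf, hg, ShortcutNetwork.eval, sub_neg_eq_add]
  have h2 : ((HiddenLayers.input.layer T₁).layer T₂).eval thresholdActivation x = z := by
    funext j
    rw [HiddenLayers.eval, h1]
  rw [h2, add_dotProduct, Matrix.mulVec_transpose, ← Matrix.dotProduct_mulVec, dotProduct_comm x]

theorem exists_mem_PWL_not_continuous (hn : 1 ≤ n) : ∃ f ∈ PWL n, ¬ Continuous f := by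
  let p : (Fin n → ℝ) →ᵃ[ℝ] ℝ := coordAffineMap ⟨0, hn⟩
  refine ⟨fun x => thresholdActivation (p x), mem_PWL_iff.2 ⟨{p}, fun s => ?_⟩, fun hc => ?_⟩
  · refine ⟨AffineMap.const ℝ _ (if s ⟨p, by simp⟩ = 1 then 1 else 0), fun x hx => ?_⟩
    beta_reduce
    rw [thresholdActivation_eq, ← hx]
    rfl
  · have hcl : IsClosed {t : ℝ | thresholdActivation t = 1} := by
      have : Continuous fun t : ℝ => thresholdActivation (p fun _ => t) :=
        hc.comp (continuous_pi fun _ => continuous_id)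
      exact isClosed_eq this continuous_const
    have hset : {t : ℝ | thresholdActivation t = 1} = Set.Ioi 0 := by
      ext t
      simp [thresholdActivation]
    rw [hset] at hcl
    have h0 : (0 : ℝ) ∈ closure (Set.Ioi (0 : ℝ)) := by
      rw [closure_Ioi]
      exact Set.self_mem_Ici
    rw [hcl.closure_eq] at h0
    exact lt_irrefl (0 : ℝ) (Set.mem_Ioi.1 h0)

end SignCellClosure

end Networks

theorem mainTheorem3 (n : ℕ) (hn : 1 ≤ n) :
    ReLUClass n ⌈Real.logb 2 ((n : ℝ) + 1)⌉₊ = CPWL n ∧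
      CPWL n ⊂ PWL n ∧
      PWL n = SLTClass n 2 := by
  refine ⟨ReLUClass_eq_CPWL ?_, ⟨fun f hf => hf.1, fun h => ?_⟩,
    PWL_subset_SLTClass.antisymm SLTClass_subset_PWL⟩
  · have h := Nat.le_ceil (Real.logb 2 ((n : ℝ) + 1))
    rw [Real.logb_le_iff_le_rpow one_lt_two (by positivity), Real.rpow_natCast] at h
    exact_mod_cast h
  · obtain ⟨f, hf, hc⟩ := exists_mem_PWL_not_continuous hn
    exact hc (h hf).2
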